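/- Let $\mathcal H_s$ and $\mathcal H_E$ be complex Hilbert spaces, let $\mathcal H=\mathcal H_s\otimes\mathcal H_E$ be their Hilbert space tensor product, let $\psi_1,\psi_2\in\mathcal H_s$ satisfy $\langle\psi_i,\psi_j\rangle=\delta_{ij}$, let $U$ be a unitary operator on $\mathcal H$, put $u(a)=UaU^*$, let $0<\varepsilon<1/2$, and put $\phi=\frac1{\sqrt2}(\psi_1+\psi_2)$. A density operator is a positive bounded operator of trace $1$, $\sqrt\rho$ denotes its positive square root, $\langle a,b\rangle_{HS}=\operatorname{Tr}(a^*b)$ is the Hilbert--Schmidt scalar product, and $P_\psi$ is the orthogonal projection onto $\mathbb C\psi$. (a) (Impure states.) Let $A_1,A_2$ be sets of density operators on $\mathcal H$ with $|\langle\sqrt{\rho_1},\sqrt{\rho_2}\rangle_{HS}|<\varepsilon$ for all $\rho_1\in A_1$, $\rho_2\in A_2$. Let $E$ be a density operator on $\mathcal H_E$ such that $\rho_s\otimes E\in A_1$ for all density operators $\rho_s$ on $\mathcal H_s$, and assume $u(P_{\psi_i}\otimes E)\in A_i$ for $i=1,2$. Then the pure state $P_\phi$ has a neighborhood $\mathcal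 D$ in the set of density operators on $\mathcal H_s$ (with respect to the Hilbert--Schmidt norm) such that $u(\rho_s\otimes E)\notin A_1\cup A_2$ for all $\rho_s\in\mathcal D$. (b) (Pure states.) Let $B_1,B_2$ be subsets of the unit sphere of $\mathcal H$ with $|\langle x,y\rangle|^2<\varepsilon$ for all $x\in B_1$, $y\in B_2$. Let $P$ be the set of unit vectors $e\in\mathcal H_E$ such that $\psi\otimes e\in B_1$ for all unit vectors $\psi\in\mathcal H_s$, and assume $U(\psi_i\otimes e)\in B_i$ for all $e\in P$ and $i=1,2$. Then $\phi$ has a neighborhood $\mathcal D$ in $\mathcal H_s$ such that $U(\psi\otimes e)\notin B_1\cup B_2$ for all unit vectors $\psi\in\mathcal D$ and all $e\in P$. -/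

import Mathlib

open scoped TensorProduct Topology

noncomputable section

namespace QMP

/-- The Hilbert space tensor product of `H` and `K`: the completion of the algebraic tensor product
with its canonical inner product `⟪x ⊗ y, x' ⊗ y'⟫ = ⟪x, x'⟫ * ⟪y, y'⟫`. -/
abbrev HilbertTensor (H K : Type*) [NormedAddCommGroup H] [InnerProductSpace ℂ H]
    [NormedAddCommGroup K] [InnerProductSpace ℂ K] : Type _ :=
  UniformSpace.Completion (H ⊗[ℂ] K)

section Tensor

variable {H K : Type*} [NormedAddCommGroup H] [InnerProductSpace ℂ H]
  [NormedAddCommGroup K] [InnerProductSpace ℂ K]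

/-- The product vector `x ⊗ y`. -/
def vecTensor (x : H) (y : K) : HilbertTensor H K :=
  ((x ⊗ₜ[ℂ] y : H ⊗[ℂ] K) : UniformSpace.Completion (H ⊗[ℂ] K))

/-- The product operator `a ⊗ b`: the continuous extension of the algebraic tensor product of the
bounded operators `a` and `b`. -/
def opTensor (a : H →L[ℂ] H) (b : K →L[ℂ] K) : HilbertTensor H K →L[ℂ] HilbertTensor H K :=
  (TensorProduct.mapL a b).completion

/-- The product operator acts factorwise on product vectors. -/
theorem opTensor_vecTensor (a : H →L[ℂ] H) (b : K →L[ℂ] K) (x : H) (y : K) :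
    opTensor a b (vecTensor x y) = vecTensor (a x) (b y) := by
  have h : (opTensor a b : HilbertTensor H K → HilbertTensor H K)
      = UniformSpace.Completion.map (TensorProduct.mapL a b) := rfl
  rw [h, vecTensor, UniformSpace.Completion.map_coe (TensorProduct.mapL a b).uniformContinuous]
  rfl

end Tensor

section Operators

variable {H : Type*} [NormedAddCommGroup H] [InnerProductSpace ℂ H] [CompleteSpace H]

variable (H) in
/-- A fixed orthonormal (Hilbert) basis of `H`. -/
def stdBasis : HilbertBasis (exists_hilbertBasis ℂ H).choose ℂ H :=
  (exists_hilbertBasis ℂ H).choose_spec.choose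

/-- `Tr a = ∑ᵢ ⟪eᵢ, a eᵢ⟫` over an orthonormal basis. For positive operators and for products of
two Hilbert-Schmidt operators (the only ones it is used for) the sum does not depend on the
basis. -/
def trace (a : H →L[ℂ] H) : ℂ :=
  ∑' i, inner ℂ (stdBasis H i) (a (stdBasis H i))

/-- The Hilbert-Schmidt scalar product `⟨a, b⟩ = Tr (a* b)`. -/
def hsInner (a b : H →L[ℂ] H) : ℂ :=
  trace (star a * b)

/-- The Hilbert-Schmidt norm `√(Tr (a* a))`. -/
def hsNorm (a : H →L[ℂ] H) : ℝ :=
  Real.sqrt (hsInner a a).re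

variable (H) in
/-- The density operators on `H`: the positive bounded operators that have a finite trace, equal
to `1`. -/
def densityOperators : Set (H →L[ℂ] H) :=
  {ρ | ρ.IsPositive ∧ Summable (fun i => inner ℂ (stdBasis H i) (ρ (stdBasis H i))) ∧ trace ρ = 1}

/-- `P_ψ`: the orthogonal projection onto the line spanned by `ψ`. -/
def lineProj (ψ : H) : H →L[ℂ] H :=
  (Submodule.span ℂ {ψ}).starProjection

/-- `D` is a neighborhood of `σ` within the set of density operators on `H`, with respect to the
Hilbert-Schmidt norm. -/
def IsDensityNhd (D : Set (H →L[ℂ] H)) (σ : H →L[ℂ] H) : Prop :=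
  D ⊆ densityOperators H ∧
    ∃ δ : ℝ, 0 < δ ∧ ∀ ρ ∈ densityOperators H, hsNorm (ρ - σ) < δ → ρ ∈ D

/-- The evolution `u(a) = U a U*`. -/
def evolve (U a : H →L[ℂ] H) : H →L[ℂ] H :=
  U * a * star U

end Operators

/-- The unit vectors `e` of the environment such that `ψ ⊗ e ∈ B` for every unit vector `ψ` of the
microsystem. -/
def readyVectors {H K : Type*} [NormedAddCommGroup H] [InnerProductSpace ℂ H]
    [NormedAddCommGroup K] [InnerProductSpace ℂ K] (B : Set (HilbertTensor H K)) : Set K :=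
  {e | ‖e‖ = 1 ∧ ∀ ψ : H, ‖ψ‖ = 1 → vecTensor ψ e ∈ B}

end QMP

end

/-!
Membership of the evolved state in one of the two sets is excluded by comparing it with the evolved
state of `ψ₁` or `ψ₂` that lies in the other set: the two are not almost orthogonal, because
`|⟪φ, ψᵢ⟫|² = 1/2 > ε` and the microsystem starts close to `φ`.

For vectors, `⟪U (ψ ⊗ e), U (ψᵢ ⊗ e)⟫ = ⟪ψ, ψᵢ⟫`, and continuity in `ψ` finishes the argument; the
neighborhood does not depend on `e`.

For density operators the corresponding identity is
`⟪√u(ρ ⊗ E), √u(P_ψ ⊗ E)⟫_HS = ⟪ψ, √ρ ψ⟫ * Tr E = ⟪ψ, √ρ ψ⟫` (`hsInner_sqrt_evolve`). It rests on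
`√u(ρ ⊗ E) = u(√ρ ⊗ √E)` and on the factorization `√u(P_ψ ⊗ E) = V √E V*`, with the isometry
`V y = U (ψ ⊗ y)`, which turns the trace over a basis of the tensor product into a trace over a basis
of the environment. That step is the equality of `∑ ⟪X eᵢ, Y eᵢ⟫` and `∑ ⟪Y* fⱼ, X* fⱼ⟫` for
Hilbert-Schmidt operators (`tsum_inner_eq_tsum_inner_adjoint`), so no Hilbert basis of the tensor
product has to be constructed.

Continuity of `ρ ↦ √ρ` is not needed: a density operator satisfies `‖√ρ‖ ≤ 1`, hence `ρ ≤ √ρ`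
(`re_inner_le_re_inner_sqrt`), and `⟪ψ, ρ ψ⟫` differs from `⟪ψ, P_φ ψ⟫ = |⟪φ, ψ⟫|²` by at most the
Hilbert-Schmidt distance of `ρ` and `P_φ`.
-/

namespace QMP

/-! ### Hilbert-Schmidt operators -/

section HilbertSchmidt

variable {ι κ H K : Type*} [NormedAddCommGroup H] [InnerProductSpace ℂ H]
  [NormedAddCommGroup K] [InnerProductSpace ℂ K]

/-- Parseval's identity. -/
theorem hasSum_norm_inner_sq (f : HilbertBasis κ ℂ K) (x : K) :
    HasSum (fun j => ‖inner ℂ (f j) x‖ ^ 2) (‖x‖ ^ 2) := by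
  have h := (f.hasSum_inner_mul_inner x x).mapL Complex.reCLM
  have hre : Complex.reCLM (inner ℂ x x) = ‖x‖ ^ 2 := by
    simpa using (inner_self_eq_norm_sq (𝕜 := ℂ) x)
  rw [hre] at h
  refine h.congr_fun fun j => ?_
  rw [← inner_conj_symm x (f j), Complex.conj_mul']
  norm_cast

theorem summable_norm_inner_sq {X : H →L[ℂ] K} (e : HilbertBasis ι ℂ H) (f : HilbertBasis κ ℂ K)
    (hX : Summable fun i => ‖X (e i)‖ ^ 2) :
    Summable fun p : ι × κ => ‖inner ℂ (f p.2) (X (e p.1))‖ ^ 2 := by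
  rw [summable_prod_of_nonneg fun _ => by positivity]
  refine ⟨fun i => (hasSum_norm_inner_sq f (X (e i))).summable, ?_⟩
  simpa only [(hasSum_norm_inner_sq f _).tsum_eq] using hX

theorem summable_inner_mul_inner {X Y : H →L[ℂ] K} (e : HilbertBasis ι ℂ H)
    (f : HilbertBasis κ ℂ K) (hX : Summable fun i => ‖X (e i)‖ ^ 2)
    (hY : Summable fun i => ‖Y (e i)‖ ^ 2) :
    Summable fun p : ι × κ => inner ℂ (X (e p.1)) (f p.2) * inner ℂ (f p.2) (Y (e p.1)) := by
  refine Summable.of_norm_bounded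
    ((summable_norm_inner_sq e f hX).add (summable_norm_inner_sq e f hY)) fun p => ?_
  rw [norm_mul, norm_inner_symm]
  have h := two_mul_le_add_sq ‖inner ℂ (f p.2) (X (e p.1))‖ ‖inner ℂ (f p.2) (Y (e p.1))‖
  have h' := mul_nonneg (norm_nonneg (inner ℂ (f p.2) (X (e p.1))))
    (norm_nonneg (inner ℂ (f p.2) (Y (e p.1))))
  linarith

variable [CompleteSpace H] [CompleteSpace K]

/-- Trace cyclicity for a product of two Hilbert-Schmidt operators between different spaces:
`Tr (X* Y) = Tr (Y X*)`, each side computed in an arbitrary Hilbert basis. -/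
theorem tsum_inner_eq_tsum_inner_adjoint {X Y : H →L[ℂ] K} (e : HilbertBasis ι ℂ H)
    (f : HilbertBasis κ ℂ K) (hX : Summable fun i => ‖X (e i)‖ ^ 2)
    (hY : Summable fun i => ‖Y (e i)‖ ^ 2) :
    ∑' i, inner ℂ (X (e i)) (Y (e i)) = ∑' j, inner ℂ (Y.adjoint (f j)) (X.adjoint (f j)) := by
  have hrow (i : ι) : ∑' j, inner ℂ (X (e i)) (f j) * inner ℂ (f j) (Y (e i)) =
      inner ℂ (X (e i)) (Y (e i)) := f.tsum_inner_mul_inner _ _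
  have hcol (j : κ) : ∑' i, inner ℂ (X (e i)) (f j) * inner ℂ (f j) (Y (e i)) =
      inner ℂ (Y.adjoint (f j)) (X.adjoint (f j)) := by
    rw [← e.tsum_inner_mul_inner]
    refine tsum_congr fun i => ?_
    rw [ContinuousLinearMap.adjoint_inner_left, ContinuousLinearMap.adjoint_inner_right, mul_comm]
  simp only [← hrow, ← hcol]
  exact (Summable.tsum_comm (f := fun i j => inner ℂ (X (e i)) (f j) * inner ℂ (f j) (Y (e i)))
    (summable_inner_mul_inner e f hX hY)).symm

/-- The operator norm of `X*` is at most the Hilbert-Schmidt norm of `X`. -/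
theorem norm_adjoint_apply_sq_le {X : H →L[ℂ] K} (e : HilbertBasis ι ℂ H)
    (hX : Summable fun i => ‖X (e i)‖ ^ 2) (y : K) :
    ‖X.adjoint y‖ ^ 2 ≤ (∑' i, ‖X (e i)‖ ^ 2) * ‖y‖ ^ 2 := by
  have h := hasSum_norm_inner_sq e (X.adjoint y)
  rw [← h.tsum_eq, ← tsum_mul_right]
  refine h.summable.tsum_le_tsum (fun i => ?_) (hX.mul_right _)
  rw [ContinuousLinearMap.adjoint_inner_right, ← mul_pow]
  gcongr
  exact norm_inner_le_norm _ _

theorem hsInner_eq_tsum (a b : H →L[ℂ] H) :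
    hsInner a b = ∑' i, inner ℂ (a (stdBasis H i)) (b (stdBasis H i)) := by
  refine tsum_congr fun i => ?_
  rw [mul_apply_eq_comp, ContinuousLinearMap.star_eq_adjoint,
    ContinuousLinearMap.adjoint_inner_right]

theorem conj_hsInner (a b : H →L[ℂ] H) : starRingEnd ℂ (hsInner a b) = hsInner b a := by
  simp only [hsInner_eq_tsum, Complex.conj_tsum, inner_conj_symm]

theorem hsInner_self (a : H →L[ℂ] H) :
    hsInner a a = ((∑' i, ‖a (stdBasis H i)‖ ^ 2 : ℝ) : ℂ) := by
  rw [hsInner_eq_tsum, Complex.ofReal_tsum]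
  refine tsum_congr fun i => ?_
  rw [inner_self_eq_norm_sq_to_K]
  norm_cast

theorem hsNorm_sq (a : H →L[ℂ] H) : hsNorm a ^ 2 = ∑' i, ‖a (stdBasis H i)‖ ^ 2 := by
  rw [hsNorm, hsInner_self, Complex.ofReal_re, Real.sq_sqrt (tsum_nonneg fun _ => by positivity)]

/-- Summability has to be assumed, since `hsNorm a` is `0` when `a` is not Hilbert-Schmidt. -/
theorem norm_inner_apply_self_le_hsNorm {a : H →L[ℂ] H}
    (ha : Summable fun i => ‖a (stdBasis H i)‖ ^ 2) {ψ : H} (hψ : ‖ψ‖ = 1) :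
    ‖inner ℂ ψ (a ψ)‖ ≤ hsNorm a := by
  have h := norm_adjoint_apply_sq_le (stdBasis H) ha ψ
  rw [← hsNorm_sq, ← mul_pow, hψ, mul_one] at h
  have h' := (sq_le_sq₀ (norm_nonneg _) (Real.sqrt_nonneg _)).1 h
  rw [← ContinuousLinearMap.adjoint_inner_left]
  refine (norm_inner_le_norm _ _).trans ?_
  rwa [hψ, mul_one]

/-- If `T = V R V*` with an isometry `V : K → H`, then `Tr (S T)` can be computed over a basis
of `K`. -/
theorem hsInner_conj_isometry {V : K →L[ℂ] H} (hV : ∀ y, ‖V y‖ = ‖y‖) {S T : H →L[ℂ] H}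
    {R : K →L[ℂ] K} (hS : 0 ≤ S) (hR : 0 ≤ R) (hT : T = V ∘L R ∘L V.adjoint)
    (hSsum : Summable fun i => ‖S (stdBasis H i)‖ ^ 2)
    (hTsum : Summable fun i => ‖T (stdBasis H i)‖ ^ 2) :
    hsInner S T = ∑' j, inner ℂ (V (R (stdBasis K j))) (S (V (stdBasis K j))) := by
  have hSa : S.adjoint = S := (IsSelfAdjoint.of_nonneg hS).star_eq
  have hRa : R.adjoint = R := (IsSelfAdjoint.of_nonneg hR).star_eq
  have hVle : ‖V.adjoint‖ ≤ 1 := by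
    rw [LinearIsometryEquiv.norm_map]
    exact ContinuousLinearMap.opNorm_le_bound _ zero_le_one fun y => by rw [hV, one_mul]
  -- `Tr (S T) = ∑ ⟪V* S eᵢ, R V* eᵢ⟫`; both factors are Hilbert-Schmidt because `S` and `T` are.
  have hX : Summable fun i => ‖(V.adjoint ∘L S) (stdBasis H i)‖ ^ 2 := by
    refine hSsum.of_nonneg_of_le (fun _ => by positivity) fun i => ?_
    gcongr
    simpa using V.adjoint.le_of_opNorm_le hVle (S (stdBasis H i))
  have hY : Summable fun i => ‖(R ∘L V.adjoint) (stdBasis H i)‖ ^ 2 :=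
    hTsum.congr fun i => by rw [← hV, hT]; rfl
  have h := tsum_inner_eq_tsum_inner_adjoint (stdBasis H) (stdBasis K) hX hY
  simp only [ContinuousLinearMap.adjoint_comp, ContinuousLinearMap.adjoint_adjoint, hSa, hRa,
    ContinuousLinearMap.comp_apply, ContinuousLinearMap.adjoint_inner_left] at h
  rw [hsInner_eq_tsum, hT, ← h]
  rfl

end HilbertSchmidt

/-! ### Density operators and their square roots -/

section Density

variable {H : Type*} [NormedAddCommGroup H] [InnerProductSpace ℂ H] [CompleteSpace H]

theorem nonneg_star_mul_self (a : H →L[ℂ] H) : 0 ≤ star a * a := star_mul_self_nonneg a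

theorem inner_apply_eq_norm_sqrt_sq {ρ : H →L[ℂ] H} (hρ : 0 ≤ ρ) (x : H) :
    inner ℂ x (ρ x) = ((‖CFC.sqrt ρ x‖ ^ 2 : ℝ) : ℂ) := by
  have hsa : (CFC.sqrt ρ).adjoint = CFC.sqrt ρ :=
    (IsSelfAdjoint.of_nonneg (CFC.sqrt_nonneg ρ)).star_eq
  have hmul : CFC.sqrt ρ (CFC.sqrt ρ x) = ρ x :=
    congrArg (fun a : H →L[ℂ] H => a x) (CFC.sqrt_mul_sqrt_self ρ hρ)
  rw [← hmul, ← ContinuousLinearMap.adjoint_inner_left, hsa, inner_self_eq_norm_sq_to_K]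
  norm_cast

variable {ρ : H →L[ℂ] H}

theorem nonneg_of_mem_densityOperators (hρ : ρ ∈ densityOperators H) : 0 ≤ ρ :=
  (ContinuousLinearMap.nonneg_iff_isPositive ρ).2 hρ.1

theorem hasSum_norm_sqrt_sq (hρ : ρ ∈ densityOperators H) :
    HasSum (fun i => ‖CFC.sqrt ρ (stdBasis H i)‖ ^ 2) 1 := by
  have h := hρ.2.1.hasSum
  rw [show ∑' i, inner ℂ (stdBasis H i) (ρ (stdBasis H i)) = 1 from hρ.2.2] at h
  simp only [inner_apply_eq_norm_sqrt_sq (nonneg_of_mem_densityOperators hρ)] at h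
  exact Complex.hasSum_ofReal.1 (by simpa only [Complex.ofReal_one] using h)

theorem norm_sqrt_le_one (hρ : ρ ∈ densityOperators H) : ‖CFC.sqrt ρ‖ ≤ 1 := by
  have hsa : (CFC.sqrt ρ).adjoint = CFC.sqrt ρ :=
    (IsSelfAdjoint.of_nonneg (CFC.sqrt_nonneg ρ)).star_eq
  have hs := hasSum_norm_sqrt_sq hρ
  refine ContinuousLinearMap.opNorm_le_bound _ zero_le_one fun x => ?_
  have h := norm_adjoint_apply_sq_le (stdBasis H) hs.summable x
  rw [hs.tsum_eq, hsa, one_mul] at h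
  rw [one_mul]
  exact (sq_le_sq₀ (norm_nonneg _) (norm_nonneg _)).1 h

theorem summable_norm_sq (hρ : ρ ∈ densityOperators H) :
    Summable fun i => ‖ρ (stdBasis H i)‖ ^ 2 := by
  refine (hasSum_norm_sqrt_sq hρ).summable.of_nonneg_of_le (fun _ => by positivity) fun i => ?_
  have hmul : CFC.sqrt ρ (CFC.sqrt ρ (stdBasis H i)) = ρ (stdBasis H i) :=
    congrArg (fun a : H →L[ℂ] H => a _)
      (CFC.sqrt_mul_sqrt_self ρ (nonneg_of_mem_densityOperators hρ))
  rw [← hmul]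
  gcongr
  simpa using (CFC.sqrt ρ).le_of_opNorm_le (norm_sqrt_le_one hρ) (CFC.sqrt ρ (stdBasis H i))

/-- `ρ ≤ √ρ` for a density operator `ρ`, as `‖√ρ‖ ≤ 1`. -/
theorem re_inner_le_re_inner_sqrt (hρ : ρ ∈ densityOperators H) (x : H) :
    (inner ℂ x (ρ x)).re ≤ (inner ℂ x (CFC.sqrt ρ x)).re := by
  set r := CFC.sqrt ρ
  set q := CFC.sqrt r
  have hr : 0 ≤ r := CFC.sqrt_nonneg ρ
  have hsa : IsSelfAdjoint q := IsSelfAdjoint.of_nonneg (CFC.sqrt_nonneg r)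
  have hq : q * q = r := CFC.sqrt_mul_sqrt_self r hr
  have hnorm : ‖q‖ ≤ 1 := by
    have h : ‖q‖ * ‖q‖ ≤ 1 := by
      rw [← CStarRing.norm_star_mul_self, hsa.star_eq, hq]
      exact norm_sqrt_le_one hρ
    nlinarith [norm_nonneg q]
  rw [inner_apply_eq_norm_sqrt_sq (nonneg_of_mem_densityOperators hρ),
    inner_apply_eq_norm_sqrt_sq hr, Complex.ofReal_re, Complex.ofReal_re]
  change ‖r x‖ ^ 2 ≤ ‖q x‖ ^ 2
  rw [← hq, mul_apply_eq_comp]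
  gcongr
  simpa using q.le_of_opNorm_le hnorm (q x)

end Density

/-! ### Projections onto lines -/

section LineProj

variable {H : Type*} [NormedAddCommGroup H] [InnerProductSpace ℂ H]

theorem lineProj_apply {ψ : H} (hψ : ‖ψ‖ = 1) (x : H) : lineProj ψ x = inner ℂ ψ x • ψ :=
  Submodule.starProjection_unit_singleton ℂ hψ x

theorem inner_lineProj {φ : H} (hφ : ‖φ‖ = 1) (ψ : H) :
    inner ℂ ψ (lineProj φ ψ) = ((‖inner ℂ φ ψ‖ ^ 2 : ℝ) : ℂ) := by
  rw [lineProj_apply hφ, inner_smul_right, ← inner_conj_symm ψ φ, Complex.mul_conj']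
  norm_cast

variable [CompleteSpace H]

theorem lineProj_nonneg (ψ : H) : 0 ≤ lineProj ψ :=
  (ContinuousLinearMap.nonneg_iff_isPositive _).2
    (ContinuousLinearMap.IsPositive.of_isStarProjection isStarProjection_starProjection)

theorem sqrt_lineProj (ψ : H) : CFC.sqrt (lineProj ψ) = lineProj ψ :=
  CFC.sqrt_unique (Submodule.isIdempotentElem_starProjection _) (lineProj_nonneg ψ)

theorem lineProj_mem_densityOperators {ψ : H} (hψ : ‖ψ‖ = 1) :
    lineProj ψ ∈ densityOperators H := by
  have h : HasSum (fun i => inner ℂ (stdBasis H i) (lineProj ψ (stdBasis H i))) 1 := by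
    have := hasSum_norm_inner_sq (stdBasis H) ψ
    rw [hψ, one_pow] at this
    simp only [inner_lineProj hψ, norm_inner_symm ψ]
    simpa only [Complex.ofReal_one] using Complex.hasSum_ofReal.2 this
  exact ⟨(ContinuousLinearMap.nonneg_iff_isPositive _).1 (lineProj_nonneg ψ), h.summable, h.tsum_eq⟩

end LineProj

/-! ### Unitary evolution -/

section Unitary

variable {H : Type*} [NormedAddCommGroup H] [InnerProductSpace ℂ H] [CompleteSpace H]
  {U : H →L[ℂ] H}

theorem star_unitary_apply (hU : U ∈ unitary (H →L[ℂ] H)) (x : H) : star U (U x) = x :=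
  congrArg (fun a : H →L[ℂ] H => a x) (Unitary.star_mul_self_of_mem hU)

theorem inner_unitary_apply (hU : U ∈ unitary (H →L[ℂ] H)) (x y : H) :
    inner ℂ (U x) (U y) = inner ℂ x y := by
  rw [← ContinuousLinearMap.adjoint_inner_right, ← ContinuousLinearMap.star_eq_adjoint,
    star_unitary_apply hU]

theorem norm_unitary_apply (hU : U ∈ unitary (H →L[ℂ] H)) (x : H) : ‖U x‖ = ‖x‖ := by
  rw [← sq_eq_sq₀ (norm_nonneg _) (norm_nonneg _), ← inner_self_eq_norm_sq (𝕜 := ℂ),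
    inner_unitary_apply hU, inner_self_eq_norm_sq (𝕜 := ℂ)]

theorem evolve_apply_unitary (hU : U ∈ unitary (H →L[ℂ] H)) (a : H →L[ℂ] H) (x : H) :
    evolve U a (U x) = U (a x) := by
  rw [evolve, mul_apply_eq_comp, mul_apply_eq_comp, star_unitary_apply hU]

theorem evolve_nonneg {a : H →L[ℂ] H} (ha : 0 ≤ a) (U : H →L[ℂ] H) : 0 ≤ evolve U a :=
  star_right_conjugate_nonneg ha U

theorem sqrt_evolve (hU : U ∈ unitary (H →L[ℂ] H)) {a b : H →L[ℂ] H} (h : b * b = a)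
    (hb : 0 ≤ b) : CFC.sqrt (evolve U a) = evolve U b := by
  refine CFC.sqrt_unique ?_ (evolve_nonneg hb U)
  calc U * b * star U * (U * b * star U)
      = U * b * (star U * U) * b * star U := by simp only [mul_assoc]
    _ = evolve U a := by
      rw [Unitary.star_mul_self_of_mem hU, mul_one, mul_assoc U, h, evolve]

end Unitary

/-! ### Hilbert space tensor products -/

section Tensor

variable {H K : Type*} [NormedAddCommGroup H] [InnerProductSpace ℂ H]
  [NormedAddCommGroup K] [InnerProductSpace ℂ K]

@[simp]
theorem inner_vecTensor (x x' : H) (y y' : K) :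
    inner ℂ (vecTensor x y) (vecTensor x' y') = inner ℂ x x' * inner ℂ y y' := by
  rw [vecTensor, vecTensor, UniformSpace.Completion.inner_coe, TensorProduct.inner_tmul]

theorem norm_vecTensor (x : H) (y : K) : ‖vecTensor x y‖ = ‖x‖ * ‖y‖ := by
  rw [vecTensor, UniformSpace.Completion.norm_coe, TensorProduct.norm_tmul]

/-- Product vectors span a dense subspace, so bounded operators are determined by them. -/
theorem ext_vecTensor {F : Type*} [NormedAddCommGroup F] [NormedSpace ℂ F]
    {a b : HilbertTensor H K →L[ℂ] F} (h : ∀ x y, a (vecTensor x y) = b (vecTensor x y)) :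
    a = b := by
  ext z
  induction z using UniformSpace.Completion.induction_on with
  | hp => exact isClosed_eq a.continuous b.continuous
  | ih t =>
    induction t using TensorProduct.induction_on with
    | zero => rw [UniformSpace.Completion.coe_zero, map_zero, map_zero]
    | tmul x y => exact h x y
    | add s t hs ht => rw [UniformSpace.Completion.coe_add, map_add, map_add, hs, ht]

theorem ext_inner_vecTensor {u v : HilbertTensor H K}
    (h : ∀ x y, inner ℂ u (vecTensor x y) = inner ℂ v (vecTensor x y)) : u = v :=
  ext_inner_right ℂ fun z => congrArg (fun a : HilbertTensor H K →L[ℂ] ℂ => a z)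
    (ext_vecTensor (a := innerSL ℂ u) (b := innerSL ℂ v) h)

theorem opTensor_mul (a a' : H →L[ℂ] H) (b b' : K →L[ℂ] K) :
    opTensor a b * opTensor a' b' = opTensor (a * a') (b * b') :=
  ext_vecTensor fun x y => by simp [opTensor_vecTensor]

/-- For fixed `ψ` the map `y ↦ ψ ⊗ y`, as a bounded operator. -/
noncomputable def vecTensorL (ψ : H) : K →L[ℂ] HilbertTensor H K :=
  UniformSpace.Completion.toComplL ∘L
    (TensorProduct.mk ℂ H K ψ).mkContinuous ‖ψ‖ fun y => (TensorProduct.norm_tmul ψ y).le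

@[simp]
theorem vecTensorL_apply (ψ : H) (y : K) : vecTensorL ψ y = vecTensor ψ y := rfl

theorem adjoint_vecTensorL_vecTensor [CompleteSpace K] (ψ x : H) (y : K) :
    (vecTensorL ψ).adjoint (vecTensor x y) = inner ℂ ψ x • y :=
  ext_inner_left ℂ fun z => by
    rw [ContinuousLinearMap.adjoint_inner_right, vecTensorL_apply, inner_vecTensor,
      inner_smul_right]

/-- `P_ψ ⊗ b = W b W*` with the isometry `W y = ψ ⊗ y`. -/
theorem opTensor_lineProj [CompleteSpace K] {ψ : H} (hψ : ‖ψ‖ = 1) (b : K →L[ℂ] K) :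
    opTensor (lineProj ψ) b = vecTensorL ψ ∘L b ∘L (vecTensorL ψ).adjoint :=
  ext_vecTensor fun x y => by
    rw [opTensor_vecTensor, lineProj_apply hψ]
    simp only [ContinuousLinearMap.comp_apply, adjoint_vecTensorL_vecTensor, map_smul]
    refine ext_inner_vecTensor fun x' y' => ?_
    simp [inner_smul_left, mul_assoc, mul_left_comm]

variable [CompleteSpace H] [CompleteSpace K]

theorem star_opTensor (a : H →L[ℂ] H) (b : K →L[ℂ] K) :
    star (opTensor a b) = opTensor (star a) (star b) :=
  ext_vecTensor fun x y => ext_inner_vecTensor fun x' y' => by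
    simp [opTensor_vecTensor, ContinuousLinearMap.star_eq_adjoint,
      ContinuousLinearMap.adjoint_inner_left]

theorem opTensor_nonneg {a : H →L[ℂ] H} {b : K →L[ℂ] K} (ha : 0 ≤ a) (hb : 0 ≤ b) :
    0 ≤ opTensor a b := by
  have hsa := (IsSelfAdjoint.of_nonneg (CFC.sqrt_nonneg a)).star_eq
  have hsb := (IsSelfAdjoint.of_nonneg (CFC.sqrt_nonneg b)).star_eq
  rw [← CFC.sqrt_mul_sqrt_self a ha, ← CFC.sqrt_mul_sqrt_self b hb, ← opTensor_mul]
  nth_rw 1 [← hsa, ← hsb]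
  rw [← star_opTensor]
  exact nonneg_star_mul_self _

variable {U : HilbertTensor H K →L[ℂ] HilbertTensor H K}

theorem opTensor_sqrt_mul_self {a : H →L[ℂ] H} {b : K →L[ℂ] K} (ha : 0 ≤ a) (hb : 0 ≤ b) :
    opTensor (CFC.sqrt a) (CFC.sqrt b) * opTensor (CFC.sqrt a) (CFC.sqrt b) = opTensor a b := by
  rw [opTensor_mul, CFC.sqrt_mul_sqrt_self a ha, CFC.sqrt_mul_sqrt_self b hb]

/-- That the evolved states are density operators ensures that the sum over the basis that defines
the Hilbert-Schmidt scalar product converges. -/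
theorem hsInner_sqrt_evolve
    (hU : U ∈ unitary (HilbertTensor H K →L[ℂ] HilbertTensor H K))
    {ρ : H →L[ℂ] H} (hρ : 0 ≤ ρ) {E : K →L[ℂ] K} (hE : E ∈ densityOperators K)
    {ψ : H} (hψ : ‖ψ‖ = 1)
    (hσ : evolve U (opTensor ρ E) ∈ densityOperators (HilbertTensor H K))
    (hτ : evolve U (opTensor (lineProj ψ) E) ∈ densityOperators (HilbertTensor H K)) :
    hsInner (CFC.sqrt (evolve U (opTensor ρ E)))
      (CFC.sqrt (evolve U (opTensor (lineProj ψ) E))) = inner ℂ ψ (CFC.sqrt ρ ψ) := by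
  have hE0 := nonneg_of_mem_densityOperators hE
  have hSsum := (hasSum_norm_sqrt_sq hσ).summable
  have hTsum := (hasSum_norm_sqrt_sq hτ).summable
  have hVnorm (y : K) : ‖(U ∘L vecTensorL ψ) y‖ = ‖y‖ := by
    rw [ContinuousLinearMap.comp_apply, norm_unitary_apply hU, vecTensorL_apply, norm_vecTensor,
      hψ, one_mul]
  have hS := sqrt_evolve hU (opTensor_sqrt_mul_self hρ hE0)
    (opTensor_nonneg (CFC.sqrt_nonneg ρ) (CFC.sqrt_nonneg E))
  have hT := sqrt_evolve hU (opTensor_sqrt_mul_self (lineProj_nonneg ψ) hE0)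
    (opTensor_nonneg (CFC.sqrt_nonneg _) (CFC.sqrt_nonneg E))
  have hT' : evolve U (opTensor (CFC.sqrt (lineProj ψ)) (CFC.sqrt E)) =
      (U ∘L vecTensorL ψ) ∘L CFC.sqrt E ∘L (U ∘L vecTensorL ψ).adjoint := by
    rw [sqrt_lineProj, evolve, opTensor_lineProj hψ, ContinuousLinearMap.adjoint_comp,
      ContinuousLinearMap.star_eq_adjoint]
    rfl
  rw [hS] at hSsum ⊢
  rw [hT] at hTsum ⊢
  rw [hsInner_conj_isometry hVnorm
    (evolve_nonneg (opTensor_nonneg (CFC.sqrt_nonneg ρ) (CFC.sqrt_nonneg E)) U)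
    (CFC.sqrt_nonneg E) hT' hSsum hTsum]
  -- `⟪V √E y, u(√ρ ⊗ √E) V y⟫` factorizes over the tensor product.
  have hterm (y : K) : inner ℂ ((U ∘L vecTensorL ψ) (CFC.sqrt E y))
      (evolve U (opTensor (CFC.sqrt ρ) (CFC.sqrt E)) ((U ∘L vecTensorL ψ) y)) =
      inner ℂ ψ (CFC.sqrt ρ ψ) * inner ℂ y (E y) := by
    rw [ContinuousLinearMap.comp_apply, ContinuousLinearMap.comp_apply, evolve_apply_unitary hU,
      inner_unitary_apply hU, vecTensorL_apply, vecTensorL_apply, opTensor_vecTensor,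
      inner_vecTensor, inner_apply_eq_norm_sqrt_sq hE0, inner_self_eq_norm_sq_to_K]
    norm_cast
  simp only [hterm]
  rw [tsum_mul_left, show ∑' j, inner ℂ (stdBasis K j) (E (stdBasis K j)) = 1 from hE.2.2,
    mul_one]

theorem sub_hsNorm_le_norm_hsInner_sqrt_evolve
    (hU : U ∈ unitary (HilbertTensor H K →L[ℂ] HilbertTensor H K))
    {ρ : H →L[ℂ] H} (hρ : ρ ∈ densityOperators H) {E : K →L[ℂ] K} (hE : E ∈ densityOperators K)
    {φ ψ : H} (hφ : ‖φ‖ = 1) (hψ : ‖ψ‖ = 1)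
    (hσ : evolve U (opTensor ρ E) ∈ densityOperators (HilbertTensor H K))
    (hτ : evolve U (opTensor (lineProj ψ) E) ∈ densityOperators (HilbertTensor H K)) :
    ‖inner ℂ φ ψ‖ ^ 2 - hsNorm (ρ - lineProj φ) ≤
      ‖hsInner (CFC.sqrt (evolve U (opTensor ρ E)))
        (CFC.sqrt (evolve U (opTensor (lineProj ψ) E)))‖ := by
  rw [hsInner_sqrt_evolve hU (nonneg_of_mem_densityOperators hρ) hE hψ hσ hτ]
  have hsum : Summable fun i => ‖(ρ - lineProj φ) (stdBasis H i)‖ ^ 2 := by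
    refine (((summable_norm_sq hρ).add
      (summable_norm_sq (lineProj_mem_densityOperators hφ))).mul_left 2).of_nonneg_of_le
      (fun _ => by positivity) fun i => ?_
    rw [sub_apply]
    nlinarith [norm_sub_le (ρ (stdBasis H i)) (lineProj φ (stdBasis H i)),
      norm_nonneg (ρ (stdBasis H i) - lineProj φ (stdBasis H i)),
      sq_nonneg (‖ρ (stdBasis H i)‖ - ‖lineProj φ (stdBasis H i)‖)]
  have h1 := (Complex.abs_re_le_norm _).trans (norm_inner_apply_self_le_hsNorm hsum hψ)
  rw [sub_apply, inner_sub_right, Complex.sub_re, inner_lineProj hφ,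
    Complex.ofReal_re] at h1
  have h2 := re_inner_le_re_inner_sqrt hρ ψ
  have h3 := Complex.re_le_norm (inner ℂ ψ (CFC.sqrt ρ ψ))
  linarith [(abs_le.1 h1).1]

end Tensor

/-! ### The superposition of two orthonormal vectors -/

section Superposition

variable {H : Type*} [NormedAddCommGroup H] [InnerProductSpace ℂ H] {ψ₁ ψ₂ : H}

theorem norm_superposition (hψ : Orthonormal ℂ ![ψ₁, ψ₂]) :
    ‖((Real.sqrt 2 : ℝ) : ℂ)⁻¹ • (ψ₁ + ψ₂)‖ = 1 := by
  have h1 : ‖ψ₁‖ = 1 := hψ.1 0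
  have h2 : ‖ψ₂‖ = 1 := hψ.1 1
  have h12 : inner ℂ ψ₁ ψ₂ = 0 := hψ.2 (i := 0) (j := 1) (by decide)
  have h := norm_add_sq_eq_norm_sq_add_norm_sq_of_inner_eq_zero ψ₁ ψ₂ h12
  have h' : ‖ψ₁ + ψ₂‖ = Real.sqrt 2 := by
    rw [← Real.sqrt_sq (norm_nonneg (ψ₁ + ψ₂)), sq, h, h1, h2]
    norm_num
  rw [norm_smul, h', norm_inv, Complex.norm_real, Real.norm_of_nonneg (Real.sqrt_nonneg 2)]
  exact inv_mul_cancel₀ (by positivity)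

theorem norm_inner_superposition_sq (hψ : Orthonormal ℂ ![ψ₁, ψ₂]) :
    ‖inner ℂ (((Real.sqrt 2 : ℝ) : ℂ)⁻¹ • (ψ₁ + ψ₂)) ψ₁‖ ^ 2 = 1 / 2 ∧
      ‖inner ℂ (((Real.sqrt 2 : ℝ) : ℂ)⁻¹ • (ψ₁ + ψ₂)) ψ₂‖ ^ 2 = 1 / 2 := by
  have h1 : ‖ψ₁‖ = 1 := hψ.1 0
  have h2 : ‖ψ₂‖ = 1 := hψ.1 1
  have h12 : inner ℂ ψ₁ ψ₂ = 0 := hψ.2 (i := 0) (j := 1) (by decide)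
  have h21 : inner ℂ ψ₂ ψ₁ = 0 := hψ.2 (i := 1) (j := 0) (by decide)
  constructor <;>
    simp [h12, h21, inner_self_eq_norm_sq_to_K, h1, h2]

end Superposition

end QMP

theorem proposition6
    {Hs HE : Type*}
    [NormedAddCommGroup Hs] [InnerProductSpace ℂ Hs] [CompleteSpace Hs]
    [NormedAddCommGroup HE] [InnerProductSpace ℂ HE] [CompleteSpace HE]
    (ψ₁ ψ₂ : Hs) (hψ : Orthonormal ℂ ![ψ₁, ψ₂])
    (U : QMP.HilbertTensor Hs HE →L[ℂ] QMP.HilbertTensor Hs HE)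
    (hU : U ∈ unitary (QMP.HilbertTensor Hs HE →L[ℂ] QMP.HilbertTensor Hs HE))
    (ε : ℝ) (hε_pos : 0 < ε) (hε_lt : ε < 1 / 2) :
    -- impure states
    (∀ A₁ A₂ : Set (QMP.HilbertTensor Hs HE →L[ℂ] QMP.HilbertTensor Hs HE),
      A₁ ⊆ QMP.densityOperators (QMP.HilbertTensor Hs HE) →
      A₂ ⊆ QMP.densityOperators (QMP.HilbertTensor Hs HE) →
      (∀ ρ₁ ∈ A₁, ∀ ρ₂ ∈ A₂, ‖QMP.hsInner (CFC.sqrt ρ₁) (CFC.sqrt ρ₂)‖ < ε) →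
      ∀ E ∈ QMP.densityOperators HE,
        (∀ ρ ∈ QMP.densityOperators Hs, QMP.opTensor ρ E ∈ A₁) →
        QMP.evolve U (QMP.opTensor (QMP.lineProj ψ₁) E) ∈ A₁ →
        QMP.evolve U (QMP.opTensor (QMP.lineProj ψ₂) E) ∈ A₂ →
        ∃ D : Set (Hs →L[ℂ] Hs),
          QMP.IsDensityNhd D (QMP.lineProj (((Real.sqrt 2 : ℝ) : ℂ)⁻¹ • (ψ₁ + ψ₂))) ∧
          ∀ ρ ∈ D, QMP.evolve U (QMP.opTensor ρ E) ∉ A₁ ∪ A₂) ∧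
    -- pure states
    (∀ B₁ B₂ : Set (QMP.HilbertTensor Hs HE),
      (∀ x ∈ B₁, ‖x‖ = 1) →
      (∀ y ∈ B₂, ‖y‖ = 1) →
      (∀ x ∈ B₁, ∀ y ∈ B₂, ‖inner ℂ x y‖ ^ 2 < ε) →
      (∀ e ∈ QMP.readyVectors (H := Hs) B₁,
        U (QMP.vecTensor ψ₁ e) ∈ B₁ ∧ U (QMP.vecTensor ψ₂ e) ∈ B₂) →
      ∃ D ∈ 𝓝 (((Real.sqrt 2 : ℝ) : ℂ)⁻¹ • (ψ₁ + ψ₂)),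
        ∀ ψ ∈ D, ‖ψ‖ = 1 → ∀ e ∈ QMP.readyVectors (H := Hs) B₁,
          U (QMP.vecTensor ψ e) ∉ B₁ ∪ B₂) := by
  have h1 : ‖ψ₁‖ = 1 := hψ.1 0
  have h2 : ‖ψ₂‖ = 1 := hψ.1 1
  have hφ := QMP.norm_superposition hψ
  obtain ⟨hφ1, hφ2⟩ := QMP.norm_inner_superposition_sq hψ
  set φ : Hs := ((Real.sqrt 2 : ℝ) : ℂ)⁻¹ • (ψ₁ + ψ₂)
  constructor
  · intro A₁ A₂ hA₁ hA₂ hA E hE _ hu₁ hu₂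
    refine ⟨{ρ | ρ ∈ QMP.densityOperators Hs ∧ QMP.hsNorm (ρ - QMP.lineProj φ) < 1 / 2 - ε},
      ⟨fun ρ hρ => hρ.1, 1 / 2 - ε, by linarith, fun ρ hρ hlt => ⟨hρ, hlt⟩⟩, ?_⟩
    rintro ρ ⟨hρ, hlt⟩ (hmem | hmem)
    -- Membership in `Aᵢ` is excluded by comparison with the evolved state in the other set.
    · have h := QMP.sub_hsNorm_le_norm_hsInner_sqrt_evolve hU hρ hE hφ h2 (hA₁ hmem) (hA₂ hu₂)
      linarith [hA _ hmem _ hu₂]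
    · have h := QMP.sub_hsNorm_le_norm_hsInner_sqrt_evolve hU hρ hE hφ h1 (hA₂ hmem) (hA₁ hu₁)
      rw [← QMP.conj_hsInner, Complex.norm_conj] at h
      linarith [hA _ hu₁ _ hmem]
  · intro B₁ B₂ _ _ hB hP
    refine ⟨{ψ | ε < ‖inner ℂ ψ ψ₁‖ ^ 2 ∧ ε < ‖inner ℂ ψ ψ₂‖ ^ 2}, ?_, ?_⟩
    · refine IsOpen.mem_nhds ?_ ⟨by rw [hφ1]; exact hε_lt, by rw [hφ2]; exact hε_lt⟩
      have hopen (χ : Hs) : IsOpen {ψ : Hs | ε < ‖inner ℂ ψ χ‖ ^ 2} :=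
        isOpen_lt continuous_const (by fun_prop)
      exact (hopen ψ₁).inter (hopen ψ₂)
    · rintro ψ ⟨hψ1, hψ2⟩ - e he
      have hinner (x y : Hs) :
          inner ℂ (U (QMP.vecTensor x e)) (U (QMP.vecTensor y e)) = inner ℂ x y := by
        rw [QMP.inner_unitary_apply hU, QMP.inner_vecTensor, inner_self_eq_norm_sq_to_K, he.1]
        simp
      obtain ⟨hm₁, hm₂⟩ := hP e he
      rintro (hmem | hmem)
      · have h := hB _ hmem _ hm₂
        rw [hinner] at h
        exact lt_asymm h hψ2
      · have h := hB _ hm₁ _ hmem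
        rw [hinner, norm_inner_symm] at h
        exact lt_asymm h hψ1
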